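/- All graphs are finite and simple. A graph $G$ is equitably $k$-colorable if it has a proper coloring with colors $0,1,\dots,k-1$ whose color classes $V_0,\dots,V_{k-1}$ (some possibly empty) satisfy $\bigl||V_i|-|V_j|\bigr|\le 1$ for all $i,j$. Let $\chi_{=}(G)$ be the smallest integer $k$ such that $G$ is equitably $k$-colorable, and let $\chi_{=}^*(G)$ be the smallest integer $n$ such that $G$ is equitably $k$-colorable for all $k\ge n$. The cross product (direct product) $G_1\times G_2$ has vertex set $V(G_1)\times V(G_2)$, with $(u,x)$ and $(v,y)$ adjacent if and only if $uv\in E(G_1)$ and $xy\in E(G_2)$. Let $C_n$ denote the cycle on $n$ vertices. Theorem. Let $m,n\ge 3$. Then \[ \chi_{=}(C_m\times C_n)=\chi_{=}^*(C_m\times C_n)=\begin{cases}2,&\text{if } mn \text{ is even};\\ 3,&\text{otherwise.}\end{cases} \] -/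

import Mathlib

namespace SimpleGraph

/-- The cross product (direct product) of two simple graphs: `(u, x)` and `(v, y)` are adjacent
if and only if `u` is adjacent to `v` in the first graph and `x` is adjacent to `y` in the
second one. -/
def crossProd {α β : Type*} (G : SimpleGraph α) (H : SimpleGraph β) : SimpleGraph (α × β) where
  Adj p q := G.Adj p.1 q.1 ∧ H.Adj p.2 q.2
  symm := ⟨fun _ _ h => ⟨h.1.symm, h.2.symm⟩⟩
  loopless := ⟨fun _ h => G.irrefl h.1⟩

/-- A finite graph is equitably `k`-colorable if it has a proper coloring with the colors
`0, …, k - 1` such that the sizes of any two color classes (empty ones included) differ by at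
most one. -/
def EquitablyColorable {V : Type*} [Finite V] (G : SimpleGraph V) (k : ℕ) : Prop :=
  ∃ c : G.Coloring (Fin k), ∀ i j : Fin k,
    (c.colorClass i).ncard ≤ (c.colorClass j).ncard + 1

/-- The equitable chromatic number: the smallest `k` such that the graph is equitably
`k`-colorable. -/
noncomputable def equitableChromaticNumber {V : Type*} [Finite V] (G : SimpleGraph V) : ℕ :=
  sInf {k : ℕ | G.EquitablyColorable k}

/-- The equitable chromatic threshold: the smallest `n` such that the graph is equitably
`k`-colorable for all `k ≥ n`. -/
noncomputable def equitableChromaticThreshold {V : Type*} [Finite V] (G : SimpleGraph V) : ℕ :=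
  sInf {n : ℕ | ∀ k : ℕ, n ≤ k → G.EquitablyColorable k}

/-- A finite graph is equitably `k`-colorable for every `k` that is at least its number of
vertices, so the two minima above are taken over nonempty sets. -/
theorem equitablyColorable_of_card_le {V : Type*} [Finite V] (G : SimpleGraph V) (k : ℕ)
    (hk : Nat.card V ≤ k) : G.EquitablyColorable k := by
  have f : V ↪ Fin k := (Finite.equivFin V).toEmbedding.trans (Fin.castLEEmb hk)
  refine ⟨Coloring.mk f fun h e => h.ne (f.injective e), fun i j => ?_⟩
  refine le_trans ((Set.ncard_le_one (Set.toFinite _)).2 ?_) (Nat.le_add_left 1 _)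
  intro a ha b hb
  exact f.injective (Eq.trans ha (Eq.symm hb))

end SimpleGraph

namespace SimpleGraph

/-! Every equitable coloring with at least three colors, apart from coloring a triangle factor by
its own coordinate, comes from listing the N vertices and cutting the list into k nearly equal
intervals. If adjacent vertices are always at distance at least d in the list, no interval contains
an edge once N ≤ d * k (`lt_mul_of_div_eq`).

If one factor is an odd cycle of length 2h + 1, `skewRow` achieves d = h * n - 2, which settles all
but a few small tori; those get explicit lists. If both cycles are even, the four parity classes are
listed so that edges join only blocks two apart. An even factor gives two colors by parity of its
coordinate. When mn is odd, the diagonal walk of length mn closes up, so two colors are impossible.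
-/

/-- If the vertices can be listed so that the vertices at positions `s` and `t` are nonadjacent
whenever `⌊s k / N⌋ = ⌊t k / N⌋`, then cutting the list into `k` intervals gives an equitable
`k`-coloring. -/
theorem EquitablyColorable.of_equiv {V : Type*} [Finite V] {G : SimpleGraph V} {N k : ℕ}
    (hk : 0 < k) (e : Fin N ≃ V)
    (h : ∀ s t : Fin N, G.Adj (e s) (e t) → (s : ℕ) * k / N ≠ (t : ℕ) * k / N) :
    G.EquitablyColorable k := by
  have hlt (t : Fin N) : (t : ℕ) * k / N < k :=
    (Nat.div_lt_iff_lt_mul t.pos).2 (by nlinarith [t.2])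
  let c : G.Coloring (Fin k) :=
    Coloring.mk (fun v => ⟨(e.symm v : ℕ) * k / N, hlt _⟩) fun {v w} hvw heq =>
      h (e.symm v) (e.symm w) (by simpa using hvw) (congrArg Fin.val heq)
  -- Color i occupies the positions t with i * N ≤ t * k < (i + 1) * N; adding k - 1 before dividing
  -- by k rounds up.
  have hcard (i : Fin k) : (c.colorClass i).ncard =
      (((i : ℕ) + 1) * N + (k - 1)) / k - ((i : ℕ) * N + (k - 1)) / k := by
    have himage : c.colorClass i = (fun t : Fin N => e t) '' {t | (t : ℕ) * k / N = i} := by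
      ext v
      constructor
      · intro hv
        exact ⟨e.symm v, congrArg Fin.val hv, by simp⟩
      · rintro ⟨t, ht, rfl⟩
        refine Fin.ext ?_
        change (e.symm (e t) : ℕ) * k / N = i
        rwa [e.symm_apply_apply]
    rw [himage, Set.ncard_image_of_injective _ e.injective,
      ← Set.ncard_image_of_injective _ Fin.val_injective, ← Nat.card_Ico,
      ← Set.ncard_coe_finset]
    congr 1
    ext t
    simp only [Set.mem_image, Set.mem_ofPred_eq, Finset.coe_Ico, Set.mem_Ico]
    have key (x : ℕ) : (x + (k - 1)) / k ≤ t ↔ x ≤ t * k := by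
      rw [Nat.div_le_iff_le_mul_add_pred hk, mul_comm k t]
      omega
    rw [key, ← not_le, key, not_le]
    constructor
    · rintro ⟨u, hu, rfl⟩
      exact (Nat.div_eq_iff u.pos).1 hu |>.imp id fun h' => by
        have := u.pos
        rw [add_mul, one_mul]; omega
    · rintro ⟨h1, h2⟩
      have hN : 0 < N := by
        rcases Nat.eq_zero_or_pos N with rfl | hN
        · omega
        · exact hN
      have htN : t < N := by
        have : ((i : ℕ) + 1) * N ≤ k * N := Nat.mul_le_mul_right _ i.2
        nlinarith
      refine ⟨⟨t, htN⟩, (Nat.div_eq_iff hN).2 ⟨h1, ?_⟩, rfl⟩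
      rw [add_mul, one_mul] at h2
      simp only
      omega
  refine ⟨c, fun i j => ?_⟩
  rw [hcard, hcard]
  have bound (x : ℕ) : k * ((x + (k - 1)) / k) ≤ x + (k - 1) ∧
      x ≤ k * ((x + (k - 1)) / k) := by
    have h1 := Nat.div_add_mod (x + (k - 1)) k
    have h2 := Nat.mod_lt (x + (k - 1)) hk
    omega
  have h1 := bound (i * N)
  have h2 := bound ((i + 1) * N)
  have h3 := bound (j * N)
  have h4 := bound ((j + 1) * N)
  rw [add_mul, one_mul] at h2 h4 ⊢
  rw [add_mul, one_mul]
  generalize ((i : ℕ) * N + (k - 1)) / k = a at *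
  generalize ((i : ℕ) * N + N + (k - 1)) / k = b at *
  generalize ((j : ℕ) * N + (k - 1)) / k = a' at *
  generalize ((j : ℕ) * N + N + (k - 1)) / k = b' at *
  -- Each ceiling overshoots by at most (k - 1) / k, so two class sizes differ by less than 2.
  have : k * (b + a') < k * (b' + a + 2) := by
    simp only [mul_add]
    omega
  have := Nat.lt_of_mul_lt_mul_left this
  omega

theorem EquitablyColorable.of_position {V : Type*} [Fintype V] {G : SimpleGraph V} {k : ℕ}
    (hk : 0 < k) {N : ℕ} (hN : Fintype.card V = N) (p : V → ℕ) (hp : p.Injective)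
    (hlt : ∀ v, p v < N)
    (h : ∀ v w, G.Adj v w → p v * k / N ≠ p w * k / N) :
    G.EquitablyColorable k := by
  let f : V → Fin N := fun v => ⟨p v, hlt v⟩
  have hf : f.Bijective := (Fintype.bijective_iff_injective_and_card f).2
    ⟨fun v w hvw => hp (congrArg Fin.val hvw), by simp [hN]⟩
  let e := Equiv.ofBijective f hf
  refine .of_equiv hk e.symm fun s t hst => ?_
  have hval (s : Fin N) : p (e.symm s) = s := congrArg Fin.val (e.apply_symm_apply s)
  rw [← hval s, ← hval t]
  exact h _ _ hst

theorem EquitablyColorable.of_bijective {V : Type*} [Finite V] {G : SimpleGraph V} {k : ℕ}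
    (hk : 0 < k) {N : ℕ} (f : Fin N → V) (hf : f.Bijective)
    (h : ∀ s t : Fin N, (s : ℕ) * k / N = (t : ℕ) * k / N → ¬ G.Adj (f s) (f t)) :
    G.EquitablyColorable k :=
  .of_equiv hk (Equiv.ofBijective f hf) fun s t hst heq => h s t heq hst

theorem EquitablyColorable.of_iso {V W : Type*} [Finite V] [Finite W] {G : SimpleGraph V}
    {H : SimpleGraph W} (φ : G ≃g H) {k : ℕ} (h : H.EquitablyColorable k) :
    G.EquitablyColorable k := by
  obtain ⟨c, hc⟩ := h
  refine ⟨c.comp φ.toHom, fun i j => ?_⟩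
  have hcard (i : Fin k) :
      (Coloring.colorClass (c.comp φ.toHom) i).ncard = (c.colorClass i).ncard :=
    Set.ncard_preimage_of_injective_subset_range (f := φ) (s := c.colorClass i) φ.injective
      (by simp [φ.surjective.range_eq])
  rw [hcard, hcard]
  exact hc i j

/-! ### Adjacency in cycles and their cross products. -/

/-- The cross product is commutative. -/
def crossProdComm {α β : Type*} (G : SimpleGraph α) (H : SimpleGraph β) :
    G.crossProd H ≃g H.crossProd G where
  toEquiv := Equiv.prodComm α β
  map_rel_iff' := And.comm

theorem EquitablyColorable.crossProd_comm {α β : Type*} [Finite α] [Finite β]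
    {G : SimpleGraph α} {H : SimpleGraph β} {k : ℕ}
    (h : (H.crossProd G).EquitablyColorable k) : (G.crossProd H).EquitablyColorable k :=
  .of_iso (crossProdComm G H) h

instance {α β : Type*} (G : SimpleGraph α) (H : SimpleGraph β) [DecidableRel G.Adj]
    [DecidableRel H.Adj] : DecidableRel (G.crossProd H).Adj :=
  fun p q => inferInstanceAs (Decidable (G.Adj p.1 q.1 ∧ H.Adj p.2 q.2))

theorem cycleGraph_adj_iff_val {n : ℕ} (hn : 3 ≤ n) (a b : Fin n) :
    (cycleGraph n).Adj a b ↔ (b : ℕ) = a + 1 ∨ (a : ℕ) = b + 1 ∨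
      ((a : ℕ) = 0 ∧ (b : ℕ) = n - 1) ∨ ((b : ℕ) = 0 ∧ (a : ℕ) = n - 1) := by
  have ha := a.2
  have hb := b.2
  rw [cycleGraph_adj', Fin.sub_def, Fin.sub_def]
  simp only
  rcases lt_trichotomy (a : ℕ) b with h | h | h
  · rw [Nat.mod_eq_of_lt (by omega : n - (b : ℕ) + a < n),
      show n - (a : ℕ) + b = (b - a) + n by omega, Nat.add_mod_right,
      Nat.mod_eq_of_lt (by omega)]
    omega
  · rw [h, Nat.sub_add_cancel hb.le, Nat.mod_self]
    omega
  · rw [Nat.mod_eq_of_lt (by omega : n - (a : ℕ) + b < n),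
      show n - (b : ℕ) + a = (a - b) + n by omega, Nat.add_mod_right,
      Nat.mod_eq_of_lt (by omega)]
    omega

theorem mod_eq_self_or_sub {x m : ℕ} (hx : x < 2 * m) :
    (x < m ∧ x % m = x) ∨ (m ≤ x ∧ x % m = x - m) := by
  rcases lt_or_ge x m with h | h
  · exact .inl ⟨h, Nat.mod_eq_of_lt h⟩
  · exact .inr ⟨h, by rw [Nat.mod_eq_sub_mod h, Nat.mod_eq_of_lt (by omega)]⟩

/-! ### Tori with an odd factor: the skew listing. -/

/-- List the rows of the torus in steps of two, each from left to right, where the rows are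
shifted by one after every `h` rows. -/
def skewRow (h n : ℕ) (hn : 3 ≤ n) (x : Fin (2 * h + 1) × Fin n) :
    Fin (2 * h + 1) × Fin n :=
  (⟨2 * x.1 % (2 * h + 1), Nat.mod_lt _ (by omega)⟩,
    ⟨((x.2 : ℕ) + (x.1 : ℕ) / h) % n, Nat.mod_lt _ (by omega)⟩)

theorem skewRow_bijective {h n : ℕ} (hh : 1 ≤ h) (hn : 3 ≤ n) :
    (skewRow h n hn).Bijective := by
  apply Function.Injective.bijective_of_finite
  rintro ⟨s, u⟩ ⟨s', u'⟩ heq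
  simp only [skewRow, Prod.mk.injEq, Fin.mk.injEq] at heq
  obtain ⟨h1, h2⟩ := heq
  have hs := s.2
  have hs' := s'.2
  have hu := u.2
  have hu' := u'.2
  have e : s = s' := by
    rcases mod_eq_self_or_sub (by omega : 2 * (s : ℕ) < 2 * (2 * h + 1)) with h3 | h3 <;>
    rcases mod_eq_self_or_sub (by omega : 2 * (s' : ℕ) < 2 * (2 * h + 1)) with h4 | h4 <;>
    exact Fin.ext (by omega)
  subst e
  have hd : (s : ℕ) / h < 3 := (Nat.div_lt_iff_lt_mul (by omega)).2 (by omega)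
  have e : u = u' := by
    rcases mod_eq_self_or_sub (by omega : (u : ℕ) + (s : ℕ) / h < 2 * n) with h3 | h3 <;>
    rcases mod_eq_self_or_sub (by omega : (u' : ℕ) + (s : ℕ) / h < 2 * n) with h4 | h4 <;>
    exact Fin.ext (by omega)
  rw [e]

/-- Doubling modulo 2h + 1 puts neighboring rows h or h + 1 places apart. At h + 1 the spare row
absorbs any column difference. At h the later row has one extra shift, so neighbors satisfy u' ≡ u
or u' ≡ u - 2 modulo n. Wrapping around then only increases the distance; unshifted, it could cost n
- 1. -/
theorem skewRow_adj_position {h n : ℕ} (hh : 1 ≤ h) (hn : 3 ≤ n)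
    {x y : Fin (2 * h + 1) × Fin n}
    (hxy : ((cycleGraph (2 * h + 1)).crossProd (cycleGraph n)).Adj
      (skewRow h n hn x) (skewRow h n hn y)) (hle : x.1 ≤ y.1) :
    (finProdFinEquiv x : ℕ) + (h * n - 2) ≤ finProdFinEquiv y := by
  obtain ⟨s, u⟩ := x
  obtain ⟨s', u'⟩ := y
  obtain ⟨h1, h2⟩ := hxy
  rw [cycleGraph_adj_iff_val (by omega)] at h1 h2
  simp only [skewRow] at h1 h2
  simp only [finProdFinEquiv_apply_val]
  have hs := s.2
  have hs' := s'.2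
  have hu := u.2
  have hu' := u'.2
  replace hle : (s : ℕ) ≤ s' := hle
  have hrow : (s' : ℕ) = s + h ∨ (s' : ℕ) = s + h + 1 := by
    rcases mod_eq_self_or_sub (by omega : 2 * (s : ℕ) < 2 * (2 * h + 1)) with h3 | h3 <;>
    rcases mod_eq_self_or_sub (by omega : 2 * (s' : ℕ) < 2 * (2 * h + 1)) with h4 | h4 <;>
    omega
  rcases hrow with e | e
  · have hd : (s : ℕ) / h < 2 := (Nat.div_lt_iff_lt_mul (by omega)).2 (by omega)
    have hd' : (s' : ℕ) / h = s / h + 1 := by rw [e, Nat.add_div_right _ (by omega)]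
    rw [hd'] at h2
    rw [e, mul_add, mul_comm n h]
    have := Nat.mul_le_mul hh hn
    have hcol : (u : ℕ) ≤ u' + 2 := by
      rcases mod_eq_self_or_sub (by omega : (u : ℕ) + (s : ℕ) / h < 2 * n) with h3 | h3 <;>
      rcases mod_eq_self_or_sub
        (by omega : (u' : ℕ) + ((s : ℕ) / h + 1) < 2 * n) with h4 | h4 <;>
      omega
    omega
  · rw [e, mul_add, mul_add, mul_comm n h]
    omega

theorem lt_mul_of_div_eq {s t k N d : ℕ} (hN : 0 < N) (hst : s + d ≤ t)
    (heq : s * k / N = t * k / N) : d * k < N := by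
  have h1 := Nat.div_add_mod (s * k) N
  have h2 := Nat.div_add_mod (t * k) N
  have h3 := Nat.mod_lt (t * k) hN
  have h4 := Nat.mul_le_mul_right k hst
  rw [heq] at h1
  rw [add_mul] at h4
  omega

theorem equitablyColorable_cycle_crossProd_of_odd {h n k : ℕ} (hh : 1 ≤ h) (hn : 3 ≤ n)
    (hk : 0 < k) (hle : (2 * h + 1) * n ≤ (h * n - 2) * k) :
    ((cycleGraph (2 * h + 1)).crossProd (cycleGraph n)).EquitablyColorable k := by
  have hN : 0 < (2 * h + 1) * n := by positivity
  refine .of_equiv hk (finProdFinEquiv.symm.trans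
    (Equiv.ofBijective _ (skewRow_bijective hh hn))) fun s t hst heq => ?_
  simp only [Equiv.trans_apply, Equiv.ofBijective_apply] at hst
  refine hle.not_gt ?_
  rcases le_total (finProdFinEquiv.symm s).1 (finProdFinEquiv.symm t).1 with hl | hl
  · exact lt_mul_of_div_eq hN
      (by simpa only [Equiv.apply_symm_apply] using skewRow_adj_position hh hn hst hl) heq
  · exact lt_mul_of_div_eq hN
      (by simpa only [Equiv.apply_symm_apply] using skewRow_adj_position hh hn hst.symm hl)
      heq.symm

/-! ### Tori with an even factor. -/

theorem equitablyColorable_cycle_crossProd_two {a n : ℕ} (ha : 2 ≤ a) (hn : 3 ≤ n) :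
    ((cycleGraph (2 * a)).crossProd (cycleGraph n)).EquitablyColorable 2 := by
  have hbound (v : Fin (2 * a) × Fin n) : (v.1 : ℕ) / 2 * n + v.2 < a * n := by
    have h1 : (v.1 : ℕ) / 2 + 1 ≤ a := by omega
    have := Nat.mul_le_mul_right n h1
    rw [add_mul] at this
    omega
  have hpos : 0 < 2 * a * n := by positivity
  refine .of_position (N := 2 * a * n) (by norm_num) (by simp)
    (fun v => (v.1 : ℕ) % 2 * (a * n) + ((v.1 : ℕ) / 2 * n + v.2)) ?_ ?_ ?_
  · intro v w h
    simp only at h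
    have hv := hbound v
    have hw := hbound w
    have h1 : (v.1 : ℕ) % 2 = (w.1 : ℕ) % 2 := by
      rcases Nat.mod_two_eq_zero_or_one v.1 with e | e <;>
      rcases Nat.mod_two_eq_zero_or_one w.1 with e' | e' <;>
      simp only [e, e', zero_mul, one_mul] at h ⊢ <;> omega
    rw [h1] at h
    replace h := Nat.add_left_cancel h
    have h2 := congrArg (· / n) h
    have h3 := congrArg (· % n) h
    simp only [mul_comm _ n, Nat.mul_add_div (by omega : n > 0), Nat.div_eq_of_lt v.2.2,
      Nat.div_eq_of_lt w.2.2, Nat.mul_add_mod, Nat.mod_eq_of_lt v.2.2,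
      Nat.mod_eq_of_lt w.2.2] at h2 h3
    exact Prod.ext (Fin.ext (by omega)) (Fin.ext h3)
  · intro v
    have := hbound v
    rw [mul_assoc]
    rcases Nat.mod_two_eq_zero_or_one v.1 with e | e <;>
    simp only [e, zero_mul, one_mul] <;> omega
  · intro v w hvw heq
    have hv := hbound v
    have hw := hbound w
    have h1 := (cycleGraph_adj_iff_val (by omega) _ _).1 hvw.1
    have hval (v : Fin (2 * a) × Fin n) :
        ((v.1 : ℕ) % 2 * (a * n) + ((v.1 : ℕ) / 2 * n + v.2)) * 2 / (2 * a * n) =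
          (v.1 : ℕ) % 2 := by
      have := hbound v
      rw [Nat.div_eq_iff hpos, mul_assoc 2 a n]
      rcases Nat.mod_two_eq_zero_or_one v.1 with e | e <;>
      simp only [e, zero_mul, one_mul] <;> omega
    rw [hval, hval] at heq
    omega

/-- In the product of two even cycles, list the parity classes (even, odd), (even, even),
(odd, even), (odd, odd) one after the other. -/
theorem equitablyColorable_cycle_crossProd_of_even {a b k : ℕ} (ha : 2 ≤ a) (hb : 2 ≤ b)
    (hk : 3 ≤ k) :
    ((cycleGraph (2 * a)).crossProd (cycleGraph (2 * b))).EquitablyColorable k := by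
  have hbound (v : Fin (2 * a) × Fin (2 * b)) :
      (v.1 : ℕ) / 2 * b + (v.2 : ℕ) / 2 < a * b := by
    have h1 : (v.1 : ℕ) / 2 + 1 ≤ a := by omega
    have := Nat.mul_le_mul_right b h1
    rw [add_mul] at this
    omega
  let blk : Fin (2 * a) × Fin (2 * b) → ℕ := fun v =>
    if (v.1 : ℕ) % 2 = 0 then 1 - (v.2 : ℕ) % 2 else 2 + (v.2 : ℕ) % 2
  have hblk (v) : ((v.1 : ℕ) % 2 = 0 ∧ (v.2 : ℕ) % 2 = 1 ∧ blk v = 0) ∨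
      ((v.1 : ℕ) % 2 = 0 ∧ (v.2 : ℕ) % 2 = 0 ∧ blk v = 1) ∨
      ((v.1 : ℕ) % 2 = 1 ∧ (v.2 : ℕ) % 2 = 0 ∧ blk v = 2) ∨
      ((v.1 : ℕ) % 2 = 1 ∧ (v.2 : ℕ) % 2 = 1 ∧ blk v = 3) := by
    simp only [blk]
    split_ifs <;> omega
  have hprod : 2 * a * (2 * b) = 4 * (a * b) := by ring
  have hpos : 0 < a * b := by positivity
  refine .of_position (N := 4 * (a * b)) (by omega) (by simp [hprod])
    (fun v => blk v * (a * b) + ((v.1 : ℕ) / 2 * b + (v.2 : ℕ) / 2)) ?_ ?_ ?_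
  · intro v w h
    simp only at h
    have hv := hbound v
    have hw := hbound w
    have h0 : blk v = blk w := by
      rcases hblk v with e | e | e | e <;> rcases hblk w with e' | e' | e' | e' <;>
      simp only [e, e', zero_mul, one_mul] at h ⊢ <;> omega
    rw [h0] at h
    replace h := Nat.add_left_cancel h
    have hv2 : (v.2 : ℕ) / 2 < b := by omega
    have hw2 : (w.2 : ℕ) / 2 < b := by omega
    have h2 := congrArg (· / b) h
    have h3 := congrArg (· % b) h
    simp only [mul_comm _ b, Nat.mul_add_div (by omega : b > 0), Nat.div_eq_of_lt hv2,
      Nat.div_eq_of_lt hw2, Nat.mul_add_mod, Nat.mod_eq_of_lt hv2, Nat.mod_eq_of_lt hw2] at h2 h3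
    have hv' := hblk v
    have hw' := hblk w
    exact Prod.ext (Fin.ext (by omega)) (Fin.ext (by omega))
  · intro v
    have := hbound v
    rcases hblk v with e | e | e | e <;> simp only [e, zero_mul, one_mul] <;> omega
  · have main (v w : Fin (2 * a) × Fin (2 * b)) (h1 : blk w = blk v + 2)
        (heq : (blk v * (a * b) + ((v.1 : ℕ) / 2 * b + (v.2 : ℕ) / 2)) * k / (4 * (a * b)) =
          (blk w * (a * b) + ((w.1 : ℕ) / 2 * b + (w.2 : ℕ) / 2)) * k / (4 * (a * b))) :
        False := by
      have hv := hbound v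
      have hw := hbound w
      -- Blocks two apart are more than N / 4 apart, enough for k ≥ 4. For k = 3 the cuts at 4ab/3
      -- and 8ab/3 separate block 0 from 2 and block 1 from 3.
      rcases eq_or_lt_of_le hk with rfl | hk
      · have hcase : blk v = 0 ∨ blk v = 1 := by
          have := hblk w
          omega
        rw [h1] at heq
        rcases hcase with e | e
        · rw [e, Nat.div_eq_of_lt (by omega), eq_comm, Nat.div_eq_iff (by omega)] at heq
          omega
        · rw [e] at heq
          have h2 : (1 * (a * b) + ((v.1 : ℕ) / 2 * b + (v.2 : ℕ) / 2)) * 3 / (4 * (a * b)) < 2 :=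
            (Nat.div_lt_iff_lt_mul (by omega)).2 (by omega)
          have h3 : 2 ≤ ((1 + 2) * (a * b) + ((w.1 : ℕ) / 2 * b + (w.2 : ℕ) / 2)) * 3 /
              (4 * (a * b)) := (Nat.le_div_iff_mul_le (by omega)).2 (by omega)
          omega
      · have h2 := lt_mul_of_div_eq (d := a * b) (by omega)
          (by rw [h1, add_mul]; omega) heq
        have := Nat.mul_le_mul_left (a * b) hk
        omega
    intro v w hvw heq
    have h1 := (cycleGraph_adj_iff_val (by omega) _ _).1 hvw.1
    have h2 := (cycleGraph_adj_iff_val (by omega) _ _).1 hvw.2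
    have hv' := hblk v
    have hw' := hblk w
    have : blk w = blk v + 2 ∨ blk v = blk w + 2 := by omega
    rcases this with h | h
    · exact main v w h heq
    · exact main w v h heq.symm

/-! ### Small tori and the case analysis for an odd factor. -/

theorem equitablyColorable_crossProd_fin {m : ℕ} {β : Type*} [Finite β]
    (G : SimpleGraph (Fin m)) (H : SimpleGraph β) : (G.crossProd H).EquitablyColorable m := by
  let c : (G.crossProd H).Coloring (Fin m) := Coloring.mk Prod.fst fun h => h.1.ne
  refine ⟨c, fun i j => ?_⟩
  have hcard (i : Fin m) : (c.colorClass i).ncard = Nat.card β := by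
    have : c.colorClass i = {i} ×ˢ (Set.univ : Set β) := by
      ext v
      simp only [Set.mem_prod, Set.mem_singleton_iff, Set.mem_univ, and_true]
      rfl
    rw [this, Set.ncard_prod, Set.ncard_singleton, Set.ncard_univ, one_mul]
  rw [hcard, hcard]
  exact Nat.le_succ _

/-- The skew listing guarantees only distance 1 here, so one explicit list serves all k from 4 to 8.
-/
theorem equitablyColorable_cycle_three_three {k : ℕ} (hk : 4 ≤ k) :
    ((cycleGraph 3).crossProd (cycleGraph 3)).EquitablyColorable k := by
  rcases le_or_gt 9 k with h | h
  · exact equitablyColorable_of_card_le _ _ (by simpa using h)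
  · refine .of_bijective (N := 9) (by omega)
      ![(0, 0), (0, 1), (0, 2), (1, 2), (1, 1), (1, 0), (2, 0), (2, 1), (2, 2)]
      (by decide) ?_
    interval_cases k <;> decide

theorem equitablyColorable_cycle_three_four {k : ℕ} (hk : 4 ≤ k) (hk' : k ≤ 5) :
    ((cycleGraph 3).crossProd (cycleGraph 4)).EquitablyColorable k := by
  refine .of_bijective (N := 12) (by omega)
    ![(0, 0), (0, 1), (0, 2), (0, 3), (1, 3), (1, 1), (1, 0), (1, 2), (2, 0), (2, 1), (2, 2),
      (2, 3)] (by decide) ?_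
  interval_cases k <;> decide

theorem equitablyColorable_cycle_three_six :
    ((cycleGraph 3).crossProd (cycleGraph 6)).EquitablyColorable 4 :=
  .of_bijective (N := 18) (by norm_num)
    ![(0, 0), (0, 1), (0, 2), (0, 3), (0, 4), (0, 5), (1, 5), (1, 1), (1, 3),
      (1, 0), (1, 2), (1, 4), (2, 0), (2, 2), (2, 1), (2, 3), (2, 4), (2, 5)] (by decide)
    (by decide)

theorem equitablyColorable_cycle_five_four :
    ((cycleGraph 5).crossProd (cycleGraph 4)).EquitablyColorable 3 :=
  .of_bijective (N := 20) (by norm_num)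
    ![(0, 0), (0, 1), (0, 2), (0, 3), (2, 0), (2, 1), (2, 2), (2, 3), (4, 0), (4, 1), (4, 2),
      (4, 3), (1, 1), (1, 3), (1, 0), (1, 2), (3, 0), (3, 1), (3, 2), (3, 3)] (by decide)
    (by decide)

theorem equitablyColorable_cycle_five_five :
    ((cycleGraph 5).crossProd (cycleGraph 5)).EquitablyColorable 3 :=
  .of_bijective (N := 25) (by norm_num)
    ![(0, 0), (0, 1), (0, 2), (0, 3), (0, 4), (2, 0), (2, 1), (2, 2), (2, 3), (2, 4), (4, 0),
      (4, 1), (4, 2), (4, 3), (4, 4), (1, 1), (1, 2), (1, 0), (1, 3), (1, 4), (3, 0), (3, 1),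
      (3, 2), (3, 3), (3, 4)] (by decide)
    (by decide)

theorem equitablyColorable_cycle_crossProd_of_odd_left {m n k : ℕ} (hodd : Odd m) (hm : 3 ≤ m)
    (hn : 3 ≤ n) (hk : 3 ≤ k) :
    ((cycleGraph m).crossProd (cycleGraph n)).EquitablyColorable k := by
  have generic {h n l k : ℕ} (hh : 1 ≤ h) (hn : 3 ≤ n) (hl : 0 < l) (hlk : l ≤ k)
      (hle : (2 * h + 1) * n ≤ (h * n - 2) * l) :
      ((cycleGraph (2 * h + 1)).crossProd (cycleGraph n)).EquitablyColorable k :=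
    equitablyColorable_cycle_crossProd_of_odd hh hn (by omega)
      (hle.trans (Nat.mul_le_mul_left _ hlk))
  obtain ⟨h, rfl⟩ := hodd
  have hsub {x : ℕ} (hx : (2 * h + 1) * n + x * 2 ≤ h * n * x) :
      (2 * h + 1) * n ≤ (h * n - 2) * x := by
    rw [Nat.sub_mul, mul_comm 2 x]
    exact Nat.le_sub_of_add_le hx
  obtain rfl | rfl | hh : h = 1 ∨ h = 2 ∨ 3 ≤ h := by omega
  · rcases eq_or_lt_of_le hk with rfl | hk
    · exact equitablyColorable_crossProd_fin _ _
    -- For h = 1 and k = 4 the bound 3n ≤ 4(n - 2) needs n ≥ 8. For n = 5 and n = 7, exchanging the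
    -- factors makes the bound hold.
    obtain rfl | rfl | rfl | rfl | rfl | hn8 :
      n = 3 ∨ n = 4 ∨ n = 5 ∨ n = 6 ∨ n = 7 ∨ 8 ≤ n := by omega
    · exact equitablyColorable_cycle_three_three hk
    · rcases le_or_gt k 5 with hk5 | hk5
      · exact equitablyColorable_cycle_three_four hk hk5
      · exact generic (l := 6) (by norm_num) hn (by norm_num) hk5 (by norm_num)
    · exact .crossProd_comm (generic (h := 2) (l := 4) (by norm_num) (by norm_num)
        (by norm_num) hk (by norm_num))
    · rcases eq_or_lt_of_le (Nat.succ_le_of_lt hk) with rfl | hk5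
      · exact equitablyColorable_cycle_three_six
      · exact generic (l := 5) (by norm_num) hn (by norm_num) hk5 (by norm_num)
    · exact .crossProd_comm (generic (h := 3) (l := 4) (by norm_num) (by norm_num)
        (by norm_num) hk (by norm_num))
    · exact generic (l := 4) (by norm_num) hn (by norm_num) hk (by omega)
  · rcases eq_or_lt_of_le hk with rfl | hk
    · obtain rfl | rfl | rfl | hn6 : n = 3 ∨ n = 4 ∨ n = 5 ∨ 6 ≤ n := by omega
      · exact .crossProd_comm (equitablyColorable_crossProd_fin _ _)
      · exact equitablyColorable_cycle_five_four
      · exact equitablyColorable_cycle_five_five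
      · exact generic (l := 3) (by norm_num) hn (by norm_num) le_rfl (by omega)
    · exact generic (l := 4) (by norm_num) hn (by norm_num) hk (by omega)
  · exact generic (l := 3) (by omega) hn (by norm_num) hk (hsub (by nlinarith))

theorem equitablyColorable_cycle_crossProd {m n k : ℕ} (hm : 3 ≤ m) (hn : 3 ≤ n) (hk : 3 ≤ k) :
    ((cycleGraph m).crossProd (cycleGraph n)).EquitablyColorable k := by
  rcases Nat.even_or_odd m with hm' | hm'
  · rcases Nat.even_or_odd n with hn' | hn'
    · obtain ⟨a, rfl⟩ := hm'.exists_two_nsmul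
      obtain ⟨b, rfl⟩ := hn'.exists_two_nsmul
      simp only [smul_eq_mul] at hm hn ⊢
      exact equitablyColorable_cycle_crossProd_of_even (by omega) (by omega) hk
    · exact .crossProd_comm (equitablyColorable_cycle_crossProd_of_odd_left hn' hn hm hk)
  · exact equitablyColorable_cycle_crossProd_of_odd_left hm' hm hn hk

theorem equitablyColorable_two_cycle_crossProd_of_even {m n : ℕ} (hm : 3 ≤ m) (hn : 3 ≤ n)
    (h : Even (m * n)) : ((cycleGraph m).crossProd (cycleGraph n)).EquitablyColorable 2 := by
  have main {m n : ℕ} (hm : 3 ≤ m) (hn : 3 ≤ n) (h : Even m) :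
      ((cycleGraph m).crossProd (cycleGraph n)).EquitablyColorable 2 := by
    obtain ⟨a, rfl⟩ := h.exists_two_nsmul
    simp only [smul_eq_mul] at hm ⊢
    exact equitablyColorable_cycle_crossProd_two (by omega) hn
  rcases Nat.even_mul.1 h with h | h
  · exact main hm hn h
  · exact .crossProd_comm (main hn hm h)

/-! ### Lower bounds and conclusion. -/

theorem cycleGraph_adj_mod_succ {n : ℕ} (hn : 3 ≤ n) (t : ℕ) :
    (cycleGraph n).Adj ⟨t % n, Nat.mod_lt _ (by omega)⟩
      ⟨(t + 1) % n, Nat.mod_lt _ (by omega)⟩ := by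
  rw [cycleGraph_adj_iff_val hn]
  simp only
  have h := Nat.mod_lt t (by omega : n > 0)
  rw [Nat.add_mod, Nat.mod_eq_of_lt (by omega : 1 < n)]
  rcases mod_eq_self_or_sub (by omega : t % n + 1 < 2 * n) with h' | h' <;> omega

theorem not_colorable_one_cycle_crossProd {m n : ℕ} (hm : 3 ≤ m) (hn : 3 ≤ n) :
    ¬ ((cycleGraph m).crossProd (cycleGraph n)).Colorable 1 := by
  rintro ⟨c⟩
  exact c.valid (v := (_, _)) (w := (_, _))
    ⟨cycleGraph_adj_mod_succ hm 0, cycleGraph_adj_mod_succ hn 0⟩ (Subsingleton.elim _ _)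

theorem not_colorable_two_cycle_crossProd_of_odd {m n : ℕ} (hm : 3 ≤ m) (hn : 3 ≤ n)
    (hodd : Odd (m * n)) : ¬ ((cycleGraph m).crossProd (cycleGraph n)).Colorable 2 := by
  rintro ⟨c⟩
  let v : ℕ → Fin m × Fin n := fun t =>
    (⟨t % m, Nat.mod_lt _ (by omega)⟩, ⟨t % n, Nat.mod_lt _ (by omega)⟩)
  have hne (t : ℕ) : c (v t) ≠ c (v (t + 1)) :=
    c.valid ⟨cycleGraph_adj_mod_succ hm t, cycleGraph_adj_mod_succ hn t⟩
  -- With two colors, the color must alternate along the diagonal walk.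
  have hpar (t : ℕ) : (c (v t) : ℕ) % 2 = (c (v 0) + t) % 2 := by
    induction t with
    | zero => rfl
    | succ t ih =>
      have := Fin.val_ne_of_ne (hne t)
      omega
  have hend : v (m * n) = v 0 := by simp [v]
  have := hpar (m * n)
  rw [hend] at this
  obtain ⟨r, hr⟩ := hodd
  omega

theorem EquitablyColorable.colorable {V : Type*} [Finite V] {G : SimpleGraph V} {k : ℕ}
    (h : G.EquitablyColorable k) : G.Colorable k :=
  let ⟨c, _⟩ := h
  ⟨c⟩

theorem equitableChromaticNumber_eq_of_forall {V : Type*} [Finite V] {G : SimpleGraph V} {b : ℕ}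
    (h : ∀ k, b ≤ k → G.EquitablyColorable k) (h' : ∀ k, G.Colorable k → b ≤ k) :
    G.equitableChromaticNumber = b :=
  le_antisymm (Nat.sInf_le (h b le_rfl))
    (le_csInf ⟨b, h b le_rfl⟩ fun k hk => h' k (EquitablyColorable.colorable hk))

theorem equitableChromaticThreshold_eq_of_forall {V : Type*} [Finite V] {G : SimpleGraph V}
    {b : ℕ} (h : ∀ k, b ≤ k → G.EquitablyColorable k) (h' : ∀ k, G.Colorable k → b ≤ k) :
    G.equitableChromaticThreshold = b :=
  le_antisymm (Nat.sInf_le h) (le_csInf ⟨b, h⟩ fun k hk => h' k (hk k le_rfl).colorable)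

/-- The lower bound concerns arbitrary proper colorings, so the same value bounds both equitable
invariants from below. -/
theorem cycle_crossProd_equitable {m n : ℕ} (hm : 3 ≤ m) (hn : 3 ≤ n) :
    (∀ k, (if Even (m * n) then 2 else 3) ≤ k →
      ((cycleGraph m).crossProd (cycleGraph n)).EquitablyColorable k) ∧
    ∀ k, ((cycleGraph m).crossProd (cycleGraph n)).Colorable k →
      (if Even (m * n) then 2 else 3) ≤ k := by
  split_ifs with h
  · refine ⟨fun k hk => ?_, fun k hk => ?_⟩
    · rcases eq_or_lt_of_le hk with rfl | hk
      · exact equitablyColorable_two_cycle_crossProd_of_even hm hn h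
      · exact equitablyColorable_cycle_crossProd hm hn hk
    · by_contra! hlt
      exact not_colorable_one_cycle_crossProd hm hn (hk.mono (by omega))
  · refine ⟨fun k hk => equitablyColorable_cycle_crossProd hm hn hk, fun k hk => ?_⟩
    by_contra! hlt
    exact not_colorable_two_cycle_crossProd_of_odd hm hn (Nat.not_even_iff_odd.1 h)
      (hk.mono (by omega))

end SimpleGraph

theorem theorem11 (m n : ℕ) (hm : 3 ≤ m) (hn : 3 ≤ n) :
    ((SimpleGraph.cycleGraph m).crossProd (SimpleGraph.cycleGraph n)).equitableChromaticNumber =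
      ((SimpleGraph.cycleGraph m).crossProd
        (SimpleGraph.cycleGraph n)).equitableChromaticThreshold ∧
    ((SimpleGraph.cycleGraph m).crossProd
        (SimpleGraph.cycleGraph n)).equitableChromaticThreshold =
      if Even (m * n) then 2 else 3 := by
  obtain ⟨h, h'⟩ := SimpleGraph.cycle_crossProd_equitable hm hn
  have ht := SimpleGraph.equitableChromaticThreshold_eq_of_forall h h'
  exact ⟨(SimpleGraph.equitableChromaticNumber_eq_of_forall h h').trans ht.symm, ht⟩
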